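/- Let $\Bbbk$ be a field, $R=\Bbbk[x_1,\ldots,x_n]$, let $L\subseteq\mathbb{Z}^n$ be a lattice (a subgroup), and let $I_L=\langle x^u-x^v : u,v\in\mathbb{N}^n,\ u-v\in L\rangle\subseteq R$ be its lattice ideal. An $I_L$-fiber is a set of monomials of the form $F_u=\{x^v : v\in\mathbb{N}^n,\ v-u\in L\}$ with $u\in\mathbb{N}^n$; for a binomial $B=x^u-x^v\in I_L$ with $u\ne v$ put $F_B=F_u$ (which equals $F_v$). Two $I_L$-fibers $F,G$ are equivalent if there are $u,v\in\mathbb{N}^n$ with $x^uF\subseteq G$ and $x^vG\subseteq F$; $\overline F$ denotes the equivalence class of $F$, and $F_{\{1\}}$ is the fiber containing the monomial $1$. A minimal generating set of $I_L$ is a finite set $S=\{B_1,\ldots,B_t\}$ of binomials $x^u-x^v$ that generates $I_L$ and no proper subset of which generates $I_L$. Then the multiset \[ \{\overline F_{B_i} : F_{B_i}\notin\overline F_{\{1\}}\} \] is an invariant of $I_L$: if $S$ and $S'$ are minimal generating sets of $I_L$, then the multisets formed from $S$ and from $S'$ coincide. Consequently \[ |S|-|S'| = |\{B\in S: F_B\in\overline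 F_{\{1\}}\}| - |\{B\in S': F_B\in\overline F_{\{1\}}\}|, \] so only the part of $S$ belonging to $\overline F_{\{1\}}$ can vary in size. -/

import Mathlib

namespace LatticeIdeal

variable {n : ℕ}

/-- The integer vector `u - v ∈ ℤⁿ` of two exponent vectors `u, v ∈ ℕⁿ`. -/
def expDiff (u v : Fin n →₀ ℕ) : Fin n → ℤ := fun i => (u i : ℤ) - (v i : ℤ)

/-- The monomial `x^u` of `K[x_1, …, x_n]`. -/
noncomputable def mon (K : Type*) [Field K] (u : Fin n →₀ ℕ) : MvPolynomial (Fin n) K :=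
  MvPolynomial.monomial u 1

/-- The lattice ideal `I_L = ⟨x^u - x^v : u - v ∈ L⟩` of a lattice (subgroup) `L ⊆ ℤⁿ`. -/
noncomputable def latticeIdeal (K : Type*) [Field K] (L : AddSubgroup (Fin n → ℤ)) :
    Ideal (MvPolynomial (Fin n) K) :=
  Ideal.span {f | ∃ u v : Fin n →₀ ℕ, expDiff u v ∈ L ∧ f = mon K u - mon K v}

/-- The fiber `F_u = {x^v : v - u ∈ L}`. A monomial is identified with its exponent vector,
so a fiber is a set of exponent vectors. -/
def fiber (L : AddSubgroup (Fin n → ℤ)) (u : Fin n →₀ ℕ) : Set (Fin n →₀ ℕ) :=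
  {v | expDiff v u ∈ L}

/-- `F` is an `I_L`-fiber. -/
def IsFiber (L : AddSubgroup (Fin n → ℤ)) (F : Set (Fin n →₀ ℕ)) : Prop :=
  ∃ u, F = fiber L u

/-- `F ≡ G`: there are monomials `x^u`, `x^v` with `x^u F ⊆ G` and `x^v G ⊆ F`. -/
def FiberEquiv (F G : Set (Fin n →₀ ℕ)) : Prop :=
  ∃ u v : Fin n →₀ ℕ, (fun a => u + a) '' F ⊆ G ∧ (fun a => v + a) '' G ⊆ F

/-- The equivalence class `F̄` of a fiber `F`: all `I_L`-fibers equivalent to `F`. -/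
def fiberClass (L : AddSubgroup (Fin n → ℤ)) (F : Set (Fin n →₀ ℕ)) :
    Set (Set (Fin n →₀ ℕ)) :=
  {G | IsFiber L G ∧ FiberEquiv G F}

/-- The class of the fiber containing the monomial `1 = x^0`. -/
def fiberClassOne (L : AddSubgroup (Fin n → ℤ)) : Set (Set (Fin n →₀ ℕ)) :=
  fiberClass L (fiber L 0)

/-- A binomial is a polynomial `x^u - x^v` with `u ≠ v`. -/
def IsBinomial {K : Type*} [Field K] (B : MvPolynomial (Fin n) K) : Prop :=
  ∃ u v : Fin n →₀ ℕ, u ≠ v ∧ B = mon K u - mon K v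

/-- The fiber `F_B` of a binomial `B ∈ I_L`: the union of the fibers of the terms of `B`. The two
terms of a binomial `x^u - x^v ∈ I_L` have the same fiber, so this is `F_u`
(`fiberOf_binomial`). -/
def fiberOf {K : Type*} [Field K] (L : AddSubgroup (Fin n → ℤ)) (B : MvPolynomial (Fin n) K) :
    Set (Fin n →₀ ℕ) :=
  {a | ∃ u ∈ B.support, a ∈ fiber L u}

theorem fiber_eq_of_mem {L : AddSubgroup (Fin n → ℤ)} {u v : Fin n →₀ ℕ}
    (h : expDiff u v ∈ L) : fiber L u = fiber L v := by
  ext a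
  have e : expDiff a v = expDiff a u + expDiff u v := by
    funext i; simp [expDiff]
  simp only [fiber, Set.mem_ofPred_eq, e]
  exact (L.add_mem_cancel_right h).symm

theorem fiberOf_binomial {K : Type*} [Field K] {L : AddSubgroup (Fin n → ℤ)}
    {u v : Fin n →₀ ℕ} (huv : u ≠ v) (h : expDiff u v ∈ L) :
    fiberOf L (mon K u - mon K v) = fiber L u := by
  classical
  have hu : u ∈ (mon K u - mon K v).support := by
    simp [mon, MvPolynomial.coeff_monomial, huv.symm]
  have key : ∀ w ∈ (mon K u - mon K v).support, w = u ∨ w = v := by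
    intro w hw
    by_contra hc
    push Not at hc
    simp [mon, MvPolynomial.coeff_monomial, hc.1.symm, hc.2.symm] at hw
  ext a
  constructor
  · rintro ⟨w, hw, ha⟩
    rcases key w hw with rfl | rfl
    · exact ha
    · rw [fiber_eq_of_mem h]; exact ha
  · intro ha
    exact ⟨u, hu, ha⟩

/-- `S` is a minimal generating set of `I_L` consisting of binomials: it generates `I_L` and no
proper subset of it does. -/
def IsMinimalGeneratingSet {K : Type*} [Field K] (L : AddSubgroup (Fin n → ℤ))
    (S : Finset (MvPolynomial (Fin n) K)) : Prop :=
  (∀ B ∈ S, IsBinomial B) ∧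
  Ideal.span (S : Set (MvPolynomial (Fin n) K)) = latticeIdeal K L ∧
  ∀ T : Finset (MvPolynomial (Fin n) K), T ⊂ S →
    Ideal.span (T : Set (MvPolynomial (Fin n) K)) ≠ latticeIdeal K L

open Classical in
/-- The pure part of `S`: those `B ∈ S` with `F_B` in the class of the fiber of `1`. -/
noncomputable def purePart {K : Type*} [Field K] (L : AddSubgroup (Fin n → ℤ))
    (S : Finset (MvPolynomial (Fin n) K)) : Finset (MvPolynomial (Fin n) K) :=
  S.filter fun B => fiberOf L B ∈ fiberClassOne L

open Classical in
/-- The multiset of the classes of `F_B`, over those `B ∈ S` with `F_B` not in the class of the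
fiber of `1`. -/
noncomputable def nonpureClasses {K : Type*} [Field K] (L : AddSubgroup (Fin n → ℤ))
    (S : Finset (MvPolynomial (Fin n) K)) : Multiset (Set (Set (Fin n →₀ ℕ))) :=
  (S.filter fun B => fiberOf L B ∉ fiberClassOne L).val.map fun B => fiberClass L (fiberOf L B)

end LatticeIdeal

/-! Grade the ring by `ℤⁿ / L`: fibers are degrees, and equivalence of fibers is mutual divisibility
of degrees (`DegLE` both ways). For a degree `c` outside the class of `1`, the number of generators
in the class of `c` is the dimension of `newPart`, which is built from `L`, `K` and `c` alone and so
does not depend on `S` (`card_filter_eq_finrank`). A basis arises by shifting each such generator by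
a monomial into degree `c`. The shifts span, because generators strictly below `c` die in the
quotient and two shifts of one generator agree there: monomials dividing `1` in degree are
identified whenever their degrees coincide (`mon_sub_mon_mem_belowIdeal`). They are independent,
because such monomials are units modulo `belowIdeal`, so a relation would make a generator redundant
(`mon_mul_notMem_span_erase`). -/

namespace LatticeIdeal

open MvPolynomial

/-! ### Fibers as degrees in `ℤⁿ / L` -/

section Degree

variable {n : ℕ} (L : AddSubgroup (Fin n → ℤ))

/-- The degree of an exponent vector: its class in `ℤⁿ / L`. -/
def deg : (Fin n →₀ ℕ) →+ (Fin n → ℤ) ⧸ L where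
  toFun u := QuotientAddGroup.mk (fun i => (u i : ℤ))
  map_zero' := by
    rw [← QuotientAddGroup.mk_zero]; congr 1
  map_add' u v := by
    rw [← QuotientAddGroup.mk_add]; congr 1

variable {L}

theorem deg_eq_deg_iff {u v : Fin n →₀ ℕ} : deg L u = deg L v ↔ expDiff u v ∈ L := by
  rw [eq_comm]
  change (QuotientAddGroup.mk _ : (Fin n → ℤ) ⧸ L) = QuotientAddGroup.mk _ ↔ _
  rw [QuotientAddGroup.eq]
  have : (-(fun i => (v i : ℤ)) + fun i => (u i : ℤ)) = expDiff u v := by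
    funext i; simp [expDiff]; ring
  rw [this]

theorem mem_fiber {u v : Fin n →₀ ℕ} : v ∈ fiber L u ↔ deg L v = deg L u :=
  deg_eq_deg_iff.symm

variable (L)

/-- Some monomial multiple of `x^u` has the degree of `x^c`. -/
def DegLE (u c : Fin n →₀ ℕ) : Prop := ∃ p, deg L p + deg L u = deg L c

variable {L}

theorem DegLE.refl (u : Fin n →₀ ℕ) : DegLE L u u := ⟨0, by simp⟩

theorem DegLE.trans {u v w : Fin n →₀ ℕ} (h : DegLE L u v) (h' : DegLE L v w) : DegLE L u w := by
  obtain ⟨p, hp⟩ := h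
  obtain ⟨q, hq⟩ := h'
  exact ⟨q + p, by rw [map_add, add_assoc, hp, hq]⟩

theorem zero_degLE (u : Fin n →₀ ℕ) : DegLE L 0 u := ⟨u, by simp⟩

theorem degLE_of_deg_eq {u v : Fin n →₀ ℕ} (h : deg L u = deg L v) : DegLE L u v :=
  ⟨0, by simpa using h⟩

theorem image_fiber_subset_iff {p u v : Fin n →₀ ℕ} :
    (fun a => p + a) '' fiber L u ⊆ fiber L v ↔ deg L p + deg L u = deg L v := by
  rw [Set.image_subset_iff]
  constructor
  · intro h
    have := h (mem_fiber.2 (rfl : deg L u = deg L u))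
    simpa [mem_fiber] using this
  · intro h a ha
    rw [mem_fiber] at ha
    simp [mem_fiber, ha, h]

theorem fiberEquiv_fiber_iff {u v : Fin n →₀ ℕ} :
    FiberEquiv (fiber L u) (fiber L v) ↔ DegLE L u v ∧ DegLE L v u := by
  simp only [FiberEquiv, image_fiber_subset_iff, DegLE, exists_and_left, exists_and_right]

theorem fiber_mem_fiberClass_iff {u v : Fin n →₀ ℕ} :
    fiber L u ∈ fiberClass L (fiber L v) ↔ DegLE L u v ∧ DegLE L v u := by
  rw [← fiberEquiv_fiber_iff]
  exact ⟨fun h => h.2, fun h => ⟨⟨u, rfl⟩, h⟩⟩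

theorem fiber_mem_fiberClassOne_iff {u : Fin n →₀ ℕ} :
    fiber L u ∈ fiberClassOne L ↔ DegLE L u 0 := by
  rw [fiberClassOne, fiber_mem_fiberClass_iff]
  exact ⟨fun h => h.1, fun h => ⟨h, zero_degLE u⟩⟩

theorem fiberClass_eq_iff {u v : Fin n →₀ ℕ} :
    fiberClass L (fiber L u) = fiberClass L (fiber L v) ↔ DegLE L u v ∧ DegLE L v u := by
  constructor
  · intro h
    rw [← fiber_mem_fiberClass_iff, ← h, fiber_mem_fiberClass_iff]
    exact ⟨.refl u, .refl u⟩
  · rintro ⟨h, h'⟩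
    ext G
    refine and_congr_right ?_
    rintro ⟨w, rfl⟩
    rw [fiberEquiv_fiber_iff, fiberEquiv_fiber_iff]
    exact ⟨fun k => ⟨k.1.trans h, h'.trans k.2⟩, fun k => ⟨k.1.trans h', h.trans k.2⟩⟩

end Degree

/-! ### Homogeneous components of binomial ideals -/

section Component

variable {K : Type*} [Field K] {n : ℕ} {L : AddSubgroup (Fin n → ℤ)}

theorem mon_mul_mon (u v : Fin n →₀ ℕ) : mon K u * mon K v = mon K (u + v) := by
  simp [mon, monomial_mul]

open Classical in
/-- The component of degree `a` of a polynomial, in the grading by `ℤⁿ / L`. -/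
noncomputable def component (K : Type*) [Field K] (L : AddSubgroup (Fin n → ℤ))
    (a : (Fin n → ℤ) ⧸ L) : MvPolynomial (Fin n) K →ₗ[K] MvPolynomial (Fin n) K :=
  (basisMonomials (Fin n) K).constr K fun u => if deg L u = a then mon K u else 0

open Classical in
theorem component_mon (a : (Fin n → ℤ) ⧸ L) (u : Fin n →₀ ℕ) :
    component K L a (mon K u) = if deg L u = a then mon K u else 0 := by
  have := (basisMonomials (Fin n) K).constr_basis K
    (fun u => if deg L u = a then mon K u else 0) u
  rwa [coe_basisMonomials] at this

theorem component_mon_sub_mon {u v : Fin n →₀ ℕ} (h : deg L u = deg L v) :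
    component K L (deg L u) (mon K u - mon K v) = mon K u - mon K v := by
  rw [map_sub, component_mon, component_mon, if_pos rfl, if_pos h.symm]

/-- `B` is a difference of two monomials of the degree of `x^u`. -/
def IsDiff (L : AddSubgroup (Fin n → ℤ)) (u : Fin n →₀ ℕ) (B : MvPolynomial (Fin n) K) : Prop :=
  ∃ v, deg L u = deg L v ∧ B = mon K u - mon K v

open Classical in
theorem component_mon_mul {a : (Fin n → ℤ) ⧸ L} {w u : Fin n →₀ ℕ}
    {B : MvPolynomial (Fin n) K} (h : IsDiff L u B) :
    component K L a (mon K w * B) = if deg L w + deg L u = a then mon K w * B else 0 := by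
  obtain ⟨v, hv, rfl⟩ := h
  rw [mul_sub, mon_mul_mon, mon_mul_mon, map_sub, component_mon, component_mon, map_add, map_add,
    ← hv]
  split_ifs <;> simp

/-- The component of degree `a` of an element of the ideal generated by `T` is a linear
combination of those monomial multiples of elements of `T` that have degree `a`. -/
theorem component_mem_span {T : Set (MvPolynomial (Fin n) K)}
    {e : MvPolynomial (Fin n) K → Fin n →₀ ℕ} (hT : ∀ B ∈ T, IsDiff L (e B) B)
    {f : MvPolynomial (Fin n) K} (hf : f ∈ Ideal.span T) (a : (Fin n → ℤ) ⧸ L) :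
    component K L a f ∈
      Submodule.span K {g | ∃ B ∈ T, ∃ w, deg L w + deg L (e B) = a ∧ g = mon K w * B} := by
  classical
  -- `component` is only `K`-linear, so the induction carries all multiples `g * f`; the claim is
  -- the case `g = 1`.
  refine Submodule.span_induction (p := fun f _ => ∀ g, component K L a (g * f) ∈ _)
    ?_ ?_ ?_ ?_ hf 1 |> (by simpa using ·)
  · intro B hB g
    induction g using MvPolynomial.induction_on' with
    | monomial w r =>
      have : (monomial w r : MvPolynomial (Fin n) K) = r • mon K w := by
        simp [mon, smul_monomial]
      rw [this, smul_mul_assoc, map_smul, component_mon_mul (hT B hB)]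
      refine Submodule.smul_mem _ _ ?_
      split_ifs with h
      · exact Submodule.subset_span ⟨B, hB, w, h, rfl⟩
      · exact Submodule.zero_mem _
    | add p q hp hq => rw [add_mul, map_add]; exact Submodule.add_mem _ hp hq
  · intro g; simp
  · intro x y _ _ hx hy g
    rw [mul_add, map_add]; exact Submodule.add_mem _ (hx g) (hy g)
  · intro r x _ hx g
    rw [smul_eq_mul, ← mul_assoc]; exact hx _

/-- To show that an element of the ideal generated by `T` lies in a subspace, when it is a
difference of two monomials, it suffices to look at the multiples of elements of `T` that have
the same degree. -/
theorem mem_of_forall_mon_mul_mem {T : Set (MvPolynomial (Fin n) K)}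
    {e : MvPolynomial (Fin n) K → Fin n →₀ ℕ} (hT : ∀ B ∈ T, IsDiff L (e B) B)
    {u v : Fin n →₀ ℕ} (huv : deg L u = deg L v) (hf : mon K u - mon K v ∈ Ideal.span T)
    (P : Submodule K (MvPolynomial (Fin n) K))
    (hP : ∀ B ∈ T, ∀ w, deg L w + deg L (e B) = deg L u → mon K w * B ∈ P) :
    mon K u - mon K v ∈ P := by
  have h := component_mem_span hT hf (deg L u)
  rw [component_mon_sub_mon huv] at h
  refine Submodule.span_le.2 ?_ h
  rintro _ ⟨B, hB, w, hw, rfl⟩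
  exact hP B hB w hw

theorem mon_sub_mon_mem {u v : Fin n →₀ ℕ} (h : deg L u = deg L v) :
    mon K u - mon K v ∈ latticeIdeal K L :=
  Ideal.subset_span ⟨u, v, deg_eq_deg_iff.1 h, rfl⟩

/-- The map `φ` adds up the coefficients in each degree. It kills every multiple of a generator of
the lattice ideal, yet separates monomials of different degrees. -/
theorem deg_eq_of_mon_sub_mon_mem {u v : Fin n →₀ ℕ}
    (h : mon K u - mon K v ∈ latticeIdeal K L) : deg L u = deg L v := by
  let φ : MvPolynomial (Fin n) K →ₗ[K] ((Fin n → ℤ) ⧸ L) →₀ K :=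
    (basisMonomials (Fin n) K).constr K fun u => Finsupp.single (deg L u) 1
  have hφ (u : Fin n →₀ ℕ) : φ (mon K u) = Finsupp.single (deg L u) 1 := by
    have := (basisMonomials (Fin n) K).constr_basis K
      (fun u => Finsupp.single (deg L u) (1 : K)) u
    rwa [coe_basisMonomials] at this
  have key : ∀ f ∈ latticeIdeal K L, ∀ g, φ (g * f) = 0 := by
    intro f hf
    induction hf using Submodule.span_induction with
    | mem f hf =>
      obtain ⟨p, q, hpq, rfl⟩ := hf
      rw [← deg_eq_deg_iff] at hpq
      intro g
      induction g using MvPolynomial.induction_on' with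
      | monomial w r =>
        have : (monomial w r : MvPolynomial (Fin n) K) = r • mon K w := by
          simp [mon, smul_monomial]
        rw [this, smul_mul_assoc, map_smul, mul_sub, mon_mul_mon, mon_mul_mon, map_sub, hφ, hφ,
          map_add, map_add, hpq, sub_self, smul_zero]
      | add p q hp hq => rw [add_mul, map_add, hp, hq, add_zero]
    | zero => simp
    | add x y _ _ hx hy => intro g; rw [mul_add, map_add, hx, hy, add_zero]
    | smul r x _ hx => intro g; rw [smul_eq_mul, ← mul_assoc]; exact hx _
  have := key _ h 1
  rw [one_mul, map_sub, hφ, hφ, sub_eq_zero] at this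
  exact Finsupp.single_left_injective one_ne_zero this

end Component

/-! ### Counting the generators in one class by a dimension -/

section Rank

variable {K : Type*} [Field K] {n : ℕ} {L : AddSubgroup (Fin n → ℤ)}

/-- The ideal generated by the binomials of `I_L` whose fibers lie strictly below the one
of `x^c`. -/
noncomputable def belowIdeal (K : Type*) [Field K] (L : AddSubgroup (Fin n → ℤ))
    (c : Fin n →₀ ℕ) : Ideal (MvPolynomial (Fin n) K) :=
  Ideal.span {f | ∃ u, DegLE L u c ∧ ¬ DegLE L c u ∧ IsDiff L u f}

/-- The image in `R / belowIdeal` of the component of `I_L` of the degree of `x^c`. -/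
noncomputable def newPart (K : Type*) [Field K] (L : AddSubgroup (Fin n → ℤ))
    (c : Fin n →₀ ℕ) : Submodule K (MvPolynomial (Fin n) K ⧸ belowIdeal K L c) :=
  Submodule.span K (Ideal.Quotient.mkₐ K (belowIdeal K L c) ''
    {f | ∃ u, deg L u = deg L c ∧ IsDiff L u f})

/-- The class of `1` lies strictly below every other class; this is where the pure class has to be
excluded. -/
theorem mon_sub_mon_mem_belowIdeal {c u v : Fin n →₀ ℕ} (hc : ¬ DegLE L c 0)
    (hu : DegLE L u 0) (huv : deg L u = deg L v) : mon K u - mon K v ∈ belowIdeal K L c :=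
  Ideal.subset_span ⟨u, hu.trans (zero_degLE c), fun h => hc (h.trans hu), v, huv, rfl⟩

variable {S : Finset (MvPolynomial (Fin n) K)} {e : MvPolynomial (Fin n) K → Fin n →₀ ℕ}

/-- A multiple of `B₀` has degree at least that of `c`, so `B₀` cannot occur when an element of
degree strictly below `c` is written in terms of `S`. -/
theorem belowIdeal_le_span_erase [DecidableEq (MvPolynomial (Fin n) K)]
    (hS : Ideal.span (S : Set (MvPolynomial (Fin n) K)) = latticeIdeal K L)
    (he : ∀ B ∈ S, IsDiff L (e B) B) {c : Fin n →₀ ℕ} {B₀ : MvPolynomial (Fin n) K}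
    (hB₀ : DegLE L c (e B₀)) :
    belowIdeal K L c ≤ Ideal.span (S.erase B₀ : Finset _) := by
  refine Ideal.span_le.2 ?_
  rintro _ ⟨u, -, hcu, v, huv, rfl⟩
  have hmem : mon K u - mon K v ∈ Ideal.span (S : Set (MvPolynomial (Fin n) K)) := by
    rw [hS]; exact mon_sub_mon_mem huv
  refine mem_of_forall_mon_mul_mem (T := (S : Set (MvPolynomial (Fin n) K))) he huv hmem
    ((Ideal.span ((S.erase B₀ : Finset _) : Set (MvPolynomial (Fin n) K))).restrictScalars K) ?_
  intro B hB w hw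
  rw [Submodule.restrictScalars_mem]
  refine Ideal.mul_mem_left _ _ (Ideal.subset_span ?_)
  refine Finset.mem_coe.2 (Finset.mem_erase.2 ⟨?_, hB⟩)
  rintro rfl
  exact hcu (hB₀.trans ⟨w, hw⟩)

/-- Since `c` also divides `e B₀` in degree, some `x^q` inverts `x^p` modulo `belowIdeal`. If the
multiple were in the smaller ideal, multiplying by `x^q` would put `B₀` there too, against
minimality. -/
theorem mon_mul_notMem_span_erase [DecidableEq (MvPolynomial (Fin n) K)]
    (hS : IsMinimalGeneratingSet L S)
    (he : ∀ B ∈ S, IsDiff L (e B) B) {c p : Fin n →₀ ℕ} (hc : ¬ DegLE L c 0)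
    {B₀ : MvPolynomial (Fin n) K} (hmem : B₀ ∈ S)
    (hB₀ : DegLE L c (e B₀)) (hp : deg L p + deg L (e B₀) = deg L c) :
    mon K p * B₀ ∉ Ideal.span (S.erase B₀ : Finset _) := by
  intro h
  have hle := belowIdeal_le_span_erase hS.2.1 he hB₀
  obtain ⟨q, hq⟩ := hB₀
  have hpq : deg L (q + p) = deg L 0 := by
    rw [← hp, ← add_assoc, add_eq_right] at hq
    rw [map_add, map_zero, hq]
  have h1 := hle (mon_sub_mon_mem_belowIdeal (K := K) hc (degLE_of_deg_eq hpq) hpq)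
  have h2 : B₀ ∈ Ideal.span ((S.erase B₀ : Finset _) : Set (MvPolynomial (Fin n) K)) := by
    have h0 : mon K (0 : Fin n →₀ ℕ) = 1 := by simp [mon]
    have : mon K q * (mon K p * B₀) - B₀ * (mon K (q + p) - mon K 0) = B₀ := by
      rw [← mon_mul_mon, h0]; ring
    have h3 := Ideal.sub_mem _ (Ideal.mul_mem_left _ (mon K q) h) (Ideal.mul_mem_left _ B₀ h1)
    rwa [this] at h3
  refine hS.2.2 (S.erase B₀) (Finset.erase_ssubset hmem) ?_
  rw [← hS.2.1]
  refine le_antisymm (Ideal.span_mono (by simp)) (Ideal.span_le.2 fun B hB => ?_)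
  by_cases hBB : B = B₀
  · rwa [hBB]
  · exact Ideal.subset_span (Finset.mem_coe.2 (Finset.mem_erase.2 ⟨hBB, hB⟩))

open Classical in
/-- The number of elements of a minimal generating set in a given class other than that of `1`
is the dimension of `newPart`. -/
theorem card_filter_eq_finrank (hS : IsMinimalGeneratingSet L S)
    (he : ∀ B ∈ S, IsDiff L (e B) B) {c : Fin n →₀ ℕ} (hc : ¬ DegLE L c 0) :
    (S.filter fun B => DegLE L (e B) c ∧ DegLE L c (e B)).card =
      Module.finrank K (newPart K L c) := by
  set F := S.filter fun B => DegLE L (e B) c ∧ DegLE L c (e B) with hF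
  have hFS (B : F) : B.1 ∈ S := (Finset.mem_filter.1 B.2).1
  have hFc (B : F) : DegLE L c (e B.1) := (Finset.mem_filter.1 B.2).2.2
  choose p hp using fun B : F => (Finset.mem_filter.1 B.2).2.1
  let b : F → MvPolynomial (Fin n) K ⧸ belowIdeal K L c :=
    fun B => Ideal.Quotient.mkₐ K (belowIdeal K L c) (mon K (p B) * B.1)
  have hli : LinearIndependent K b := by
    rw [Fintype.linearIndependent_iff]
    intro r hr B₀
    by_contra hne
    have hsum : ∑ B, r B • (mon K (p B) * B.1) ∈ belowIdeal K L c := by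
      rw [← Ideal.Quotient.eq_zero_iff_mem, ← Ideal.Quotient.mkₐ_eq_mk K, map_sum]
      simpa [b] using hr
    -- All other terms of the relation already lie in the ideal of `S.erase B₀`, so the term of `B₀`
    -- does as well.
    have hN := belowIdeal_le_span_erase hS.2.1 he (hFc B₀) hsum
    rw [← Finset.add_sum_erase _ _ (Finset.mem_univ B₀)] at hN
    have hrest : ∑ B ∈ Finset.univ.erase B₀, r B • (mon K (p B) * B.1) ∈
        Ideal.span ((S.erase B₀.1 : Finset _) : Set (MvPolynomial (Fin n) K)) := by
      refine Ideal.sum_mem _ fun B hB => Submodule.smul_of_tower_mem _ _ ?_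
      refine Ideal.mul_mem_left _ _ (Ideal.subset_span (Finset.mem_coe.2 ?_))
      exact Finset.mem_erase.2 ⟨fun h => Finset.ne_of_mem_erase hB (Subtype.ext h), hFS B⟩
    have h0 := (Ideal.add_mem_iff_left _ hrest).1 hN
    refine mon_mul_notMem_span_erase hS he hc (hFS B₀) (hFc B₀) (hp B₀) ?_
    have := Submodule.smul_of_tower_mem _ (r B₀)⁻¹ h0
    rwa [smul_smul, inv_mul_cancel₀ hne, one_smul] at this
  have hspan : Submodule.span K (Set.range b) = newPart K L c := by
    refine le_antisymm (Submodule.span_le.2 ?_) (Submodule.span_le.2 ?_)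
    · rintro _ ⟨B, rfl⟩
      obtain ⟨v, hv, hB⟩ := he _ (hFS B)
      refine Submodule.subset_span ⟨_, ⟨p B + e B.1, by rw [map_add, hp], p B + v, ?_, ?_⟩, rfl⟩
      · rw [map_add, map_add, hv]
      · rw [← mon_mul_mon, ← mon_mul_mon, ← mul_sub, ← hB]
    · rintro _ ⟨_, ⟨u, huc, v, huv, rfl⟩, rfl⟩
      have hmem : mon K u - mon K v ∈ Ideal.span (S : Set (MvPolynomial (Fin n) K)) := by
        rw [hS.2.1]; exact mon_sub_mon_mem huv
      refine mem_of_forall_mon_mul_mem (T := (S : Set (MvPolynomial (Fin n) K))) he huv hmem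
        ((Submodule.span K (Set.range b)).comap
          (Ideal.Quotient.mkₐ K (belowIdeal K L c)).toLinearMap) ?_
      intro B hB w hw
      rw [huc] at hw
      change Ideal.Quotient.mkₐ K (belowIdeal K L c) (mon K w * B) ∈ Submodule.span K (Set.range b)
      by_cases hcB : DegLE L c (e B)
      · let B' : F := ⟨B, Finset.mem_filter.2 ⟨hB, ⟨w, hw⟩, hcB⟩⟩
        -- The shift `w` need not be the chosen `p B'`, but it has the same degree and, being
        -- invertible in degree, gives the same class modulo `belowIdeal`.
        have hdeg : deg L w = deg L (p B') := add_right_cancel (hw.trans (hp B').symm)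
        have hw0 : DegLE L w 0 := by
          obtain ⟨q, hq⟩ := hcB
          refine ⟨q, ?_⟩
          rwa [← hw, ← add_assoc, add_eq_right, ← map_zero (deg L)] at hq
        have : Ideal.Quotient.mkₐ K (belowIdeal K L c) (mon K w * B) = b B' := by
          rw [Ideal.Quotient.mkₐ_eq_mk]
          refine Ideal.Quotient.eq.2 ?_
          rw [← sub_mul]
          exact Ideal.mul_mem_right _ _ (mon_sub_mon_mem_belowIdeal hc hw0 hdeg)
        rw [this]
        exact Submodule.subset_span ⟨B', rfl⟩
      -- Here `B` lies strictly below `c`, so it is itself a generator of `belowIdeal`.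
      · have : Ideal.Quotient.mkₐ K (belowIdeal K L c) (mon K w * B) = 0 := by
          rw [Ideal.Quotient.mkₐ_eq_mk]
          exact Ideal.Quotient.eq_zero_iff_mem.2
            (Ideal.mul_mem_left _ _ (Ideal.subset_span ⟨e B, ⟨w, hw⟩, hcB, he B hB⟩))
        rw [this]
        exact Submodule.zero_mem _
  rw [← hspan, finrank_span_eq_card hli, Fintype.card_coe]

/-- Fixes one term of each generator, so that its fiber can be handled as the degree of `e B`;
outside `S` the value `0` is arbitrary. -/
theorem IsMinimalGeneratingSet.exists_exponent (hS : IsMinimalGeneratingSet L S) :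
    ∃ e : MvPolynomial (Fin n) K → Fin n →₀ ℕ,
      ∀ B ∈ S, IsDiff L (e B) B ∧ fiberOf L B = fiber L (e B) := by
  have h : ∀ B, ∃ u, B ∈ S → IsDiff L u B ∧ fiberOf L B = fiber L u := by
    intro B
    by_cases hB : B ∈ S
    · obtain ⟨u, v, huv, rfl⟩ := hS.1 B hB
      have hd : deg L u = deg L v :=
        deg_eq_of_mon_sub_mon_mem (K := K) (hS.2.1 ▸ Ideal.subset_span hB)
      exact ⟨u, fun _ => ⟨⟨v, hd, rfl⟩, fiberOf_binomial huv (deg_eq_deg_iff.1 hd)⟩⟩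
    · exact ⟨0, fun h => absurd h hB⟩
  choose e he using h
  exact ⟨e, he⟩

open Classical in
theorem count_nonpureClasses (hS : IsMinimalGeneratingSet L S) {c : Fin n →₀ ℕ}
    (hc : ¬ DegLE L c 0) :
    (nonpureClasses L S).count (fiberClass L (fiber L c)) =
      Module.finrank K (newPart K L c) := by
  obtain ⟨e, he⟩ := hS.exists_exponent
  rw [← card_filter_eq_finrank hS (fun B hB => (he B hB).1) hc, nonpureClasses,
    Multiset.count_map, ← Finset.filter_val, Finset.filter_filter, Finset.card_val]
  congr 1
  refine Finset.filter_congr fun B hB => ?_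
  rw [(he B hB).2, fiber_mem_fiberClassOne_iff, fiberClass_eq_iff]
  exact ⟨fun h => ⟨h.2.2, h.2.1⟩, fun h => ⟨fun h0 => hc (h.2.trans h0), h.2, h.1⟩⟩

theorem exists_of_mem_nonpureClasses (hS : IsMinimalGeneratingSet L S)
    {X : Set (Set (Fin n →₀ ℕ))} (hX : X ∈ nonpureClasses L S) :
    ∃ c, ¬ DegLE L c 0 ∧ X = fiberClass L (fiber L c) := by
  classical
  obtain ⟨e, he⟩ := hS.exists_exponent
  obtain ⟨B, hB, rfl⟩ := Multiset.mem_map.1 hX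
  obtain ⟨hB, hB1⟩ := Finset.mem_filter.1 (Finset.mem_def.2 hB)
  rw [(he B hB).2, fiber_mem_fiberClassOne_iff] at hB1
  exact ⟨e B, hB1, by rw [(he B hB).2]⟩

theorem card_eq_purePart_add_nonpureClasses (L : AddSubgroup (Fin n → ℤ))
    (S : Finset (MvPolynomial (Fin n) K)) :
    S.card = (purePart L S).card + (nonpureClasses L S).card := by
  classical
  rw [nonpureClasses, Multiset.card_map, Finset.card_val, purePart]
  exact (Finset.card_filter_add_card_filter_not _).symm

end Rank

end LatticeIdeal

theorem corollary4p12 {K : Type*} [Field K] {n : ℕ} (L : AddSubgroup (Fin n → ℤ))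
    (S S' : Finset (MvPolynomial (Fin n) K))
    (hS : LatticeIdeal.IsMinimalGeneratingSet L S)
    (hS' : LatticeIdeal.IsMinimalGeneratingSet L S') :
    LatticeIdeal.nonpureClasses L S = LatticeIdeal.nonpureClasses L S' ∧
    (S.card : ℤ) - (S'.card : ℤ) =
      ((LatticeIdeal.purePart L S).card : ℤ) - ((LatticeIdeal.purePart L S').card : ℤ) := by
  classical
  have h : LatticeIdeal.nonpureClasses L S = LatticeIdeal.nonpureClasses L S' := by
    refine Multiset.ext' fun X => ?_
    -- Classes not of this form have multiplicity zero on both sides.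
    by_cases hX : ∃ c, ¬ LatticeIdeal.DegLE L c 0 ∧
        X = LatticeIdeal.fiberClass L (LatticeIdeal.fiber L c)
    · obtain ⟨c, hc, rfl⟩ := hX
      rw [LatticeIdeal.count_nonpureClasses hS hc, LatticeIdeal.count_nonpureClasses hS' hc]
    · rw [Multiset.count_eq_zero_of_notMem
          (fun h => hX (LatticeIdeal.exists_of_mem_nonpureClasses hS h)),
        Multiset.count_eq_zero_of_notMem
          (fun h => hX (LatticeIdeal.exists_of_mem_nonpureClasses hS' h))]
  refine ⟨h, ?_⟩
  rw [LatticeIdeal.card_eq_purePart_add_nonpureClasses L S,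
    LatticeIdeal.card_eq_purePart_add_nonpureClasses L S', h]
  push_cast
  ring
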